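/- All graphs are finite simple graphs (no loops, no multiple edges) without isolated vertices. For such a graph $G$ let $\Delta(G)$ be its maximum degree, $\nu(G)$ the number of edges of a maximum matching of $G$, and $E(G)$ its edge set. Let $G$ be a finite simple graph without isolated vertices such that $\nu(G)\ge 2$, $\Delta(G)\ge 2$ and $$|E(G)|=\Delta(G)\,\nu(G)+\left\lfloor\frac{\nu(G)}{\lceil \Delta(G)/2\rceil}\right\rfloor\left\lfloor\frac{\Delta(G)}{2}\right\rfloor .$$ Then the following are equivalent: (i) $G$ is unique up to isomorphism, that is, every finite simple graph $H$ without isolated vertices with $\Delta(H)=\Delta(G)$, $\nu(H)=\nu(G)$ and $|E(H)|=|E(G)|$ is isomorphic to $G$; (ii) $\lceil \Delta(G)/2\rceil$ divides $\nu(G)$. -/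

import Mathlib

universe u v

namespace SimpleGraph

/-- The matching number `ν(G)`: the largest number of edges of a matching of `G`. For a graph on a
finite vertex type the set below is bounded and contains `0`, so the supremum is a maximum. -/
noncomputable def matchingNumber {V : Type u} (G : SimpleGraph V) : ℕ :=
  sSup {n : ℕ | ∃ M : G.Subgraph, M.IsMatching ∧ M.edgeSet.ncard = n}

/-- `G` is determined up to isomorphism by its maximum degree, its matching number and its number
of edges, among the finite simple graphs without isolated vertices. -/
def IsUniqueUpToIso {V : Type u} [Fintype V] (G : SimpleGraph V) [DecidableRel G.Adj] : Prop :=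
  ∀ (W : Type v) [Fintype W] (H : SimpleGraph W) [DecidableRel H.Adj],
    (∀ w, ¬ H.IsIsolated w) →
    H.maxDegree = G.maxDegree →
    H.matchingNumber = G.matchingNumber →
    H.edgeFinset.card = G.edgeFinset.card →
    Nonempty (G ≃g H)

end SimpleGraph

-- Let `d` be the maximum degree, `ν` the matching number and `k = ⌈d/2⌉`. By Tutte–Berge (derived
-- from `tutte`) there are a set `S` and a partition of the other vertices into classes with no
-- edges between them such that `|S| + ∑ m i ≤ ν`, where `m i` is half the size of class `i`,
-- rounded down. A vertex of `S` accounts for at most `d` edges, a class for at most `d * m i`, plus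
-- `d / 2` if `m i ≥ k`. At most `ν / k` classes earn this surplus, which gives the bound
-- `ncard_edgeSet_le`.
--
-- If `k ∣ ν`, equality leaves no slack: `S` is empty and there are `ν / k` classes, each on `2k +
-- 1` vertices with as many edges as possible (`exists_classes_of_extremal`). The complement of a
-- class is empty for even `d`, and a path on three vertices plus disjoint edges for odd `d`. So the
-- classes, and hence the graph, are determined.
--
-- If `k ∤ ν`, a disjoint union of `ν / k` such classes and at least one star is extremal.
-- `exists_hasModel_ne` changes its number of vertices but no other parameter: if there is no class,
-- two stars are glued at a leaf; otherwise a class and a star are replaced by the complement of a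
-- cycle (`d` even), or the star is hooked onto a vertex of the class of degree below `d` (`d` odd).

universe w

namespace SimpleGraph

/-! ### Matchings and the Tutte–Berge formula. -/

section Matching

variable {V : Type u} {G : SimpleGraph V}

lemma bddAbove_ncard_matching [Finite V] (G : SimpleGraph V) :
    BddAbove {n : ℕ | ∃ M : G.Subgraph, M.IsMatching ∧ M.edgeSet.ncard = n} := by
  refine ⟨G.edgeSet.ncard, ?_⟩
  rintro n ⟨M, -, rfl⟩
  exact Set.ncard_le_ncard M.edgeSet_subset (Set.toFinite _)

lemma Subgraph.IsMatching.ncard_le_matchingNumber [Finite V] {M : G.Subgraph} (hM : M.IsMatching) :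
    M.edgeSet.ncard ≤ G.matchingNumber :=
  le_csSup (bddAbove_ncard_matching G) ⟨M, hM, rfl⟩

lemma matchingNumber_le {m : ℕ} (h : ∀ M : G.Subgraph, M.IsMatching → M.edgeSet.ncard ≤ m) :
    G.matchingNumber ≤ m := by
  refine csSup_le ⟨0, ⊥, fun v hv => absurd hv (by simp), by simp⟩ ?_
  rintro n ⟨M, hM, rfl⟩
  exact h M hM

lemma Subgraph.IsMatching.ncard_verts [Finite V] {M : G.Subgraph} (hM : M.IsMatching) :
    M.verts.ncard = 2 * M.edgeSet.ncard := by
  classical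
  have := Fintype.ofFinite V
  have h := M.spanningCoe.sum_degrees_eq_twice_card_edges
  have h2 : M.spanningCoe.edgeFinset.card = M.edgeSet.ncard := by
    rw [← Set.ncard_coe_finset, coe_edgeFinset, Subgraph.edgeSet_spanningCoe]
  rw [← h2, ← h, Set.ncard_eq_toFinset_card', Finset.card_eq_sum_ones, Finset.sum_subset_zero_on_sdiff
    (Finset.subset_univ _)]
  · intro x hx
    have hx : x ∉ M.verts := by simpa using hx
    rw [← card_neighborFinset_eq_degree, Finset.card_eq_zero, Finset.eq_empty_iff_forall_notMem]
    intro y hy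
    rw [mem_neighborFinset] at hy
    exact hx (M.edge_vert hy)
  · intro x hx
    obtain ⟨y, hy, hu⟩ := hM (show x ∈ M.verts by simpa using hx)
    symm
    rw [← card_neighborFinset_eq_degree, Finset.card_eq_one]
    refine ⟨y, ?_⟩
    ext z
    rw [mem_neighborFinset, Finset.mem_singleton]
    exact ⟨fun h => hu z h, fun h => h ▸ hy⟩

/-- The join of `G` with the complete graph on `t` new vertices. -/
def joinComplete {V : Type u} (G : SimpleGraph V) (t : ℕ) : SimpleGraph (V ⊕ Fin t) where
  Adj x y := x ≠ y ∧ ∀ a b, x = .inl a → y = .inl b → G.Adj a b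
  symm := ⟨fun _ _ h => ⟨h.1.symm, fun a b ha hb => (h.2 b a hb ha).symm⟩⟩
  loopless := ⟨fun _ h => h.1 rfl⟩

/-- The edges of `M` inside `V` form a matching of `G`; the vertices of `V` that they miss are
matched injectively into the `t` new ones. -/
lemma card_le_of_isPerfectMatching_joinComplete [Fintype V] {t : ℕ}
    {M : (G.joinComplete t).Subgraph}
    (hM : M.IsPerfectMatching) : Fintype.card V ≤ 2 * G.matchingNumber + t := by
  classical
  let N : G.Subgraph :=
    { verts := {x | ∃ y, M.Adj (.inl x) (.inl y)}
      Adj := fun x y => M.Adj (.inl x) (.inl y)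
      adj_sub := fun h => (M.adj_sub h).2 _ _ rfl rfl
      edge_vert := fun h => ⟨_, h⟩
      symm := ⟨fun _ _ h => M.adj_symm h⟩ }
  have hN : N.IsMatching := by
    rintro x ⟨y, hy⟩
    exact ⟨y, hy, fun z hz => Sum.inl_injective (hM.1.eq_of_adj_left hz hy)⟩
  have h1 := hN.ncard_le_matchingNumber
  have h2 := hN.ncard_verts
  have h3 : ∀ x : V, x ∉ N.verts → ∃ i : Fin t, M.Adj (.inl x) (.inr i) := by
    intro x hx
    obtain ⟨y, hy, -⟩ := hM.1 (hM.2 (.inl x))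
    rcases y with y | i
    · exact absurd ⟨y, hy⟩ hx
    · exact ⟨i, hy⟩
  choose g hg using h3
  have h4 : N.vertsᶜ.ncard ≤ t := by
    have := Nat.card_le_card_of_injective (fun x : ↥N.vertsᶜ => g x.1 x.2) (fun x y hxy => by
      have h1 := hg x.1 x.2
      have h2 := hg y.1 y.2
      simp only at hxy
      rw [hxy] at h1
      exact Subtype.ext (Sum.inl_injective (hM.1.eq_of_adj_right h1 h2)))
    rwa [Nat.card_coe_set_eq, Nat.card_fin] at this
  have h5 := Set.ncard_add_ncard_compl N.verts
  rw [Nat.card_eq_fintype_card] at h5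
  omega

/-- The nontrivial direction of the Tutte–Berge formula: there are a set `S` of vertices and a
partition of the remaining vertices into classes without edges in between such that the resulting
upper bound for the size of a matching is attained. -/
theorem exists_card_add_sum_card_div_two_le_matchingNumber [Fintype V] [DecidableEq V]
    (G : SimpleGraph V) :
    ∃ (S : Finset V) (ι : Type u) (_ : Fintype ι) (_ : DecidableEq ι) (p : V → ι),
      (∀ x y, G.Adj x y → x ∉ S → y ∉ S → p x = p y) ∧
      S.card + ∑ i, (Finset.univ.filter fun x => x ∉ S ∧ p x = i).card / 2 ≤
        G.matchingNumber := by
  classical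
  by_cases hn : Fintype.card V ≤ 2 * G.matchingNumber + 1
  · refine ⟨∅, PUnit, inferInstance, inferInstance, fun _ => ⟨⟩, fun _ _ _ _ _ => rfl, ?_⟩
    simp
    omega
  push Not at hn
  -- Here `t = |V| - 2ν - 2`, just too few new vertices for a perfect matching, and `|V| + t` is
  -- even.
  obtain ⟨t, ht⟩ := Nat.exists_eq_add_of_lt hn
  have hno : ¬ ∃ M : (G.joinComplete t).Subgraph, M.IsPerfectMatching := by
    rintro ⟨M, hM⟩
    have := card_le_of_isPerfectMatching_joinComplete hM
    omega
  rw [tutte] at hno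
  push Not at hno
  obtain ⟨u, hu⟩ := hno
  unfold IsTutteViolator at hu
  set K := ((⊤ : (G.joinComplete t).Subgraph).deleteVerts u).coe with hK
  have hmem : ∀ x, x ∈ ((⊤ : (G.joinComplete t).Subgraph).deleteVerts u).verts ↔ x ∉ u := by
    simp
  have hcard : Nat.card ((⊤ : (G.joinComplete t).Subgraph).deleteVerts u).verts + u.ncard =
      Fintype.card V + t := by
    rw [Nat.card_coe_set_eq, show ((⊤ : (G.joinComplete t).Subgraph).deleteVerts u).verts = uᶜ by
      ext; simp, add_comm, Set.ncard_add_ncard_compl]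
    simp
  have hpar := odd_ncard_oddComponents (G := K)
  -- The number of odd components has the parity of `|V| + t - |u|`, hence of `|u|`, so exceeding
  -- `|u|` means exceeding it by 2.
  have ho : u.ncard + 2 ≤ K.oddComponents.ncard := by
    by_contra hlt
    have h1 : K.oddComponents.ncard = u.ncard + 1 := by omega
    rw [h1, Nat.odd_iff, Nat.odd_iff] at hpar
    omega
  have hadj : ∀ x y, K.Adj x y ↔ (G.joinComplete t).Adj x.1 y.1 := by
    intro x y
    have hx := (hmem _).1 x.2
    have hy := (hmem _).1 y.2
    simp [hK, hx, hy]
  -- A new vertex outside `u` would be adjacent to everything and leave a single component.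
  have hinr : ∀ i : Fin t, Sum.inr i ∈ u := by
    intro i
    by_contra hi
    have hsub : Subsingleton K.ConnectedComponent := by
      have hr : ∀ y, K.Reachable ⟨.inr i, (hmem _).2 hi⟩ y := by
        intro y
        by_cases h : (⟨.inr i, (hmem _).2 hi⟩ : ((⊤ : (G.joinComplete t).Subgraph).deleteVerts u).verts) = y
        · rw [h]
        · refine Adj.reachable ((hadj _ _).2 ⟨fun h' => h (Subtype.ext h'), ?_⟩)
          intro a b ha
          simp at ha
      refine ⟨fun a b => ?_⟩
      induction a using ConnectedComponent.ind
      induction b using ConnectedComponent.ind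
      exact ConnectedComponent.sound ((hr _).symm.trans (hr _))
    have := Set.ncard_le_one_of_subsingleton K.oddComponents
    omega
  let S : Finset V := Finset.univ.filter fun x => Sum.inl x ∈ u
  have hS : S.card + t = u.ncard := by
    have : u = ((S.map ⟨Sum.inl, Sum.inl_injective⟩ ∪
        (Finset.univ : Finset (Fin t)).map ⟨Sum.inr, Sum.inr_injective⟩ : Finset (V ⊕ Fin t)) :
          Set (V ⊕ Fin t)) := by
      ext x
      rcases x with x | i
      · simp [S]
      · simp [hinr]
    rw [this, Set.ncard_coe_finset, Finset.card_union_of_disjoint]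
    · simp
    · rw [Finset.disjoint_left]
      simp
  have hmemS : ∀ x, x ∉ S → Sum.inl x ∈ ((⊤ : (G.joinComplete t).Subgraph).deleteVerts u).verts := by
    intro x hx
    rw [hmem]
    simpa [S] using hx
  let p : V → Option K.ConnectedComponent := fun x =>
    if h : x ∉ S then some (K.connectedComponentMk ⟨.inl x, hmemS x h⟩) else none
  have : Fintype K.ConnectedComponent := Fintype.ofFinite _
  refine ⟨S, Option K.ConnectedComponent, inferInstance, inferInstance, p, ?_, ?_⟩
  · intro x y hxy hx hy
    simp only [p, hx, hy, not_false_eq_true, dite_true, Option.some.injEq]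
    refine ConnectedComponent.sound (Adj.reachable ((hadj _ _).2 ⟨?_, ?_⟩))
    · simpa using hxy.ne
    · intro a b ha hb
      simp only [Sum.inl.injEq] at ha hb
      exact ha ▸ hb ▸ hxy
  · have hfib : ∀ c : K.ConnectedComponent,
        (Finset.univ.filter fun x => x ∉ S ∧ p x = some c).card = c.supp.ncard := by
      intro c
      rw [← Set.ncard_coe_finset]
      refine Set.ncard_congr (fun x hx => ⟨.inl x, hmemS x (by
        simp only [Finset.coe_filter, Set.mem_ofPred_eq] at hx
        exact hx.2.1)⟩) ?_ ?_ ?_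
      · intro x hx
        have hx' : x ∉ S ∧ p x = some c := by simpa using hx
        simpa [p, hx'.1] using hx'.2
      · intro a b _ _ h
        simpa using h
      · rintro ⟨x | i, hx⟩ hc
        · have hxS : x ∉ S := by simpa [S] using (hmem _).1 hx
          exact ⟨x, by simpa [p, hxS] using hc, rfl⟩
        · exact absurd (hinr i) ((hmem _).1 hx)
    have hodd : K.oddComponents.ncard ≤
        ∑ c : K.ConnectedComponent, c.supp.ncard % 2 := by
      rw [Set.ncard_eq_toFinset_card', Finset.card_eq_sum_ones]
      refine (Finset.sum_le_sum fun c hc => ?_).trans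
        (Finset.sum_le_sum_of_subset (Finset.subset_univ _))
      have hc : Odd c.supp.ncard := by simpa using hc
      rw [Nat.odd_iff] at hc
      omega
    have htot : ∑ i, (Finset.univ.filter fun x => x ∉ S ∧ p x = i).card + S.card =
        Fintype.card V := by
      have h1 := Finset.card_eq_sum_card_fiberwise (f := p) (s := Finset.univ.filter (· ∉ S))
        (t := Finset.univ) (by simp)
      simp only [Finset.filter_filter] at h1
      rw [← h1, Finset.filter_notMem_eq_sdiff, Finset.card_sdiff_add_card_eq_card (Finset.subset_univ _),
        Finset.card_univ]
    rw [Fintype.sum_option] at htot ⊢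
    simp only [hfib] at htot ⊢
    have hnone : (Finset.univ.filter fun x => x ∉ S ∧ p x = none).card = 0 := by
      rw [Finset.card_eq_zero, Finset.filter_eq_empty_iff]
      intro x _ h
      simp [p, h.1] at h
    rw [hnone] at htot ⊢
    -- With `o` odd components, `2(|S| + ∑ ⌊|c|/2⌋) ≤ |V| + |S| - o ≤ |V| - t - 2 = 2ν`, since `o ≥
    -- |S| + t + 2`.
    have hdm : ∑ c : K.ConnectedComponent, c.supp.ncard =
        2 * ∑ c : K.ConnectedComponent, c.supp.ncard / 2 +
          ∑ c : K.ConnectedComponent, c.supp.ncard % 2 := by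
      rw [Finset.mul_sum, ← Finset.sum_add_distrib]
      exact Finset.sum_congr rfl fun c _ => (Nat.div_add_mod _ _).symm
    omega

end Matching

/-! ### The Chvátal–Hanson bound and its case of equality. -/

section EdgeBound

variable {V : Type u} {G : SimpleGraph V}

lemma ncard_neighborSet_eq_degree [Fintype V] [DecidableRel G.Adj] (x : V) :
    (G.neighborSet x).ncard = G.degree x := by
  rw [← card_neighborFinset_eq_degree, ← Set.ncard_coe_finset, coe_neighborFinset]

lemma ncard_edgeSet_eq_card [Fintype V] [DecidableRel G.Adj] :
    G.edgeSet.ncard = G.edgeFinset.card := by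
  rw [← Set.ncard_coe_finset, coe_edgeFinset]

lemma sum_ncard_neighborSet [Fintype V] (G : SimpleGraph V) :
    ∑ x, (G.neighborSet x).ncard = 2 * G.edgeSet.ncard := by
  classical
  simp only [ncard_neighborSet_eq_degree, ncard_edgeSet_eq_card, sum_degrees_eq_twice_card_edges]

lemma ncard_neighborSet_induce_le [Finite V] (T : Set V) (x : T) :
    ((G.induce T).neighborSet x).ncard ≤ (G.neighborSet x.1).ncard := by
  refine Set.ncard_le_ncard_of_injOn Subtype.val (fun y hy => by simpa using hy)
    Subtype.val_injective.injOn

lemma two_mul_ncard_edgeSet_le [Fintype V] {d : ℕ}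
    (hd : ∀ x, (G.neighborSet x).ncard ≤ d) :
    2 * G.edgeSet.ncard ≤ d * Fintype.card V := by
  rw [← sum_ncard_neighborSet, mul_comm d, ← Finset.card_univ, ← smul_eq_mul]
  exact Finset.sum_le_card_nsmul _ _ _ fun x _ => hd x

lemma two_mul_ncard_edgeSet_le_card_mul [Fintype V] (G : SimpleGraph V) :
    2 * G.edgeSet.ncard ≤ (Fintype.card V - 1) * Fintype.card V := by
  classical
  refine two_mul_ncard_edgeSet_le fun x => ?_
  rw [ncard_neighborSet_eq_degree]
  exact Nat.le_sub_one_of_lt (G.degree_lt_card_verts x)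

/-- The largest possible surplus of a graph on `2 * m` or `2 * m + 1` vertices with maximum degree
at most `d`, that is, of its number of edges over `d * m`. -/
lemma ncard_edgeSet_le_of_degree_le [Fintype V] {d : ℕ}
    (hd : ∀ x, (G.neighborSet x).ncard ≤ d) :
    G.edgeSet.ncard ≤ d * (Fintype.card V / 2) +
      if (d + 1) / 2 ≤ Fintype.card V / 2 then d / 2 else 0 := by
  have h1 := two_mul_ncard_edgeSet_le hd
  have h2 := two_mul_ncard_edgeSet_le_card_mul G
  set t := Fintype.card V
  set E := G.edgeSet.ncard
  obtain ⟨m, hm | hm⟩ := Nat.even_or_odd' t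
  · have : t / 2 = m := by omega
    rw [this]
    have : E ≤ d * m := by
      rw [hm] at h1
      nlinarith
    omega
  · have : t / 2 = m := by omega
    rw [this]
    rw [hm] at h1 h2
    split_ifs with h
    · have : d * (2 * m + 1) = 2 * (d * m) + d := by ring
      omega
    -- So few vertices that the complete graph gives the better bound.
    · have h3 : 2 * m + 1 ≤ d := by omega
      have : E ≤ (2 * m + 1) * m := by
        rw [Nat.add_sub_cancel] at h2
        nlinarith
      exact this.trans (Nat.mul_le_mul_right _ h3)

/-- An edge meets `S` or has both ends in one class. -/
lemma ncard_edgeSet_le_of_classes [Fintype V] {d : ℕ}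
    (hd : ∀ x, (G.neighborSet x).ncard ≤ d) {S : Finset V} {ι : Type*} [Fintype ι] {p : V → ι}
    (hp : ∀ x y, G.Adj x y → x ∉ S → y ∉ S → p x = p y) :
    G.edgeSet.ncard ≤
      d * S.card + ∑ i, (G.induce {x | x ∉ S ∧ p x = i}).edgeSet.ncard := by
  classical
  have hsub : G.edgeFinset ⊆ S.biUnion (fun s => G.incidenceFinset s) ∪
      Finset.univ.biUnion (fun i => (G.induce {x | x ∉ S ∧ p x = i}).edgeFinset.image
        (Sym2.map Subtype.val)) := by
    intro e he
    induction e with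
    | h x y =>
    rw [mem_edgeFinset, mem_edgeSet] at he
    rw [Finset.mem_union, Finset.mem_biUnion, Finset.mem_biUnion]
    by_cases hx : x ∈ S
    · exact .inl ⟨x, hx, by simp [he]⟩
    by_cases hy : y ∈ S
    · exact .inl ⟨y, hy, by simpa [mk'_mem_incidenceSet_right_iff] using he⟩
    refine .inr ⟨p x, Finset.mem_univ _, Finset.mem_image.2
      ⟨s(⟨x, hx, rfl⟩, ⟨y, hy, (hp x y he hx hy).symm⟩), ?_, rfl⟩⟩
    simpa using he
  rw [ncard_edgeSet_eq_card]
  refine (Finset.card_le_card hsub).trans ((Finset.card_union_le _ _).trans (add_le_add ?_ ?_))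
  · refine Finset.card_biUnion_le.trans ?_
    rw [mul_comm, ← smul_eq_mul]
    refine Finset.sum_le_card_nsmul _ _ _ fun x _ => ?_
    rw [card_incidenceFinset_eq_degree, ← ncard_neighborSet_eq_degree]
    exact hd x
  · refine Finset.card_biUnion_le.trans (Finset.sum_le_sum fun i _ => ?_)
    rw [ncard_edgeSet_eq_card]
    exact Finset.card_image_le

/-- The partition given by the Tutte–Berge formula, with bounds for the number of edges of `G` and
of its classes. -/
lemma exists_classes [Fintype V] {d : ℕ} (hd : ∀ x, (G.neighborSet x).ncard ≤ d) :
    ∃ (S : Finset V) (ι : Type u) (_ : Fintype ι) (_ : DecidableEq ι) (p : V → ι) (m : ι → ℕ),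
      (∀ x y, G.Adj x y → x ∉ S → y ∉ S → p x = p y) ∧
      (∀ i, m i = Nat.card {x | x ∉ S ∧ p x = i} / 2) ∧
      S.card + ∑ i, m i ≤ G.matchingNumber ∧
      (∀ i, (G.induce {x | x ∉ S ∧ p x = i}).edgeSet.ncard ≤
        d * m i + if (d + 1) / 2 ≤ m i then d / 2 else 0) ∧
      G.edgeSet.ncard ≤
        d * S.card + ∑ i, (G.induce {x | x ∉ S ∧ p x = i}).edgeSet.ncard := by
  classical
  obtain ⟨S, ι, _, _, p, hp, hν⟩ := exists_card_add_sum_card_div_two_le_matchingNumber G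
  refine ⟨S, ι, inferInstance, inferInstance, p, _, hp, fun i => rfl, ?_, fun i => ?_,
    ncard_edgeSet_le_of_classes hd hp⟩
  · convert hν using 5 with i
    rw [Nat.card_coe_set_eq, ← Set.ncard_coe_finset]
    simp
  · rw [Nat.card_eq_fintype_card]
    exact ncard_edgeSet_le_of_degree_le fun x =>
      (ncard_neighborSet_induce_le _ x).trans (hd x)

/-- The Chvátal–Hanson bound for the number of edges. -/
theorem ncard_edgeSet_le [Fintype V] {d : ℕ} (hd0 : 0 < d)
    (hd : ∀ x, (G.neighborSet x).ncard ≤ d) :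
    G.edgeSet.ncard ≤
      d * G.matchingNumber + (G.matchingNumber / ((d + 1) / 2)) * (d / 2) := by
  obtain ⟨S, ι, _, _, p, m, -, -, hν, hE, hG⟩ := exists_classes hd
  have h1 := hG.trans (Nat.add_le_add_left (Finset.sum_le_sum fun i _ => hE i) _)
  rw [Finset.sum_add_distrib, ← Finset.mul_sum, Finset.sum_ite, Finset.sum_const,
    Finset.sum_const_zero, smul_eq_mul, add_zero, ← add_assoc, ← mul_add] at h1
  refine h1.trans (add_le_add (Nat.mul_le_mul_left _ hν) (Nat.mul_le_mul_right _ ?_))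
  rw [Nat.le_div_iff_mul_le (by omega), ← smul_eq_mul]
  calc _ ≤ ∑ i ∈ Finset.univ.filter (fun i => (d + 1) / 2 ≤ m i), m i :=
        Finset.card_nsmul_le_sum _ _ _ fun i hi => (Finset.mem_filter.1 hi).2
    _ ≤ ∑ i, m i := Finset.sum_le_sum_of_subset (Finset.subset_univ _)
    _ ≤ _ := by omega

/-- If `⌈d / 2⌉` divides the matching number, a graph attaining the Chvátal–Hanson bound is a
disjoint union of graphs on `2 * ⌈d / 2⌉ + 1` vertices with the largest possible number of edges. -/
theorem exists_classes_of_extremal [Fintype V] {d : ℕ} (hd2 : 2 ≤ d)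
    (hd : ∀ x, (G.neighborSet x).ncard ≤ d) (hiso : ∀ x, ∃ y, G.Adj x y)
    (hdvd : (d + 1) / 2 ∣ G.matchingNumber)
    (hext : d * G.matchingNumber + (G.matchingNumber / ((d + 1) / 2)) * (d / 2) ≤
      G.edgeSet.ncard) :
    ∃ (ι : Type u) (_ : Fintype ι) (p : V → ι), (∀ x y, G.Adj x y → p x = p y) ∧
      Fintype.card ι = G.matchingNumber / ((d + 1) / 2) ∧
      (∀ i, Nat.card {x | p x = i} = 2 * ((d + 1) / 2) + 1) ∧
      ∀ i, d * ((d + 1) / 2) + d / 2 ≤ (G.induce {x | p x = i}).edgeSet.ncard := by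
  obtain ⟨S, ι, _, _, p, m, hp, hm, hν, hE, hG⟩ := exists_classes hd
  set k := (d + 1) / 2 with hk
  obtain ⟨q, hq⟩ := hdvd
  have hk0 : 0 < k := by omega
  rw [hq, Nat.mul_div_cancel_left _ hk0] at hext ⊢
  set B := Finset.univ.filter (fun i => k ≤ m i) with hB
  set e : ι → ℕ := fun i => (G.induce {x | x ∉ S ∧ p x = i}).edgeSet.ncard with he
  replace hG : G.edgeSet.ncard ≤ d * S.card + ∑ i, e i := hG
  have hsum : ∑ i, (d * m i + if k ≤ m i then d / 2 else 0) =
      d * ∑ i, m i + B.card * (d / 2) := by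
    rw [Finset.sum_add_distrib, ← Finset.mul_sum, Finset.sum_ite, Finset.sum_const,
      Finset.sum_const_zero, smul_eq_mul, add_zero]
  have h1 : ∑ i, e i ≤ d * ∑ i, m i + B.card * (d / 2) :=
    hsum ▸ Finset.sum_le_sum fun i _ => hE i
  have hBm : B.card * k ≤ ∑ i ∈ B, m i := by
    rw [← smul_eq_mul]
    exact Finset.card_nsmul_le_sum _ _ _ fun i hi => (Finset.mem_filter.1 hi).2
  have hsplit := Finset.sum_add_sum_compl B m
  have hBq : B.card ≤ q := by
    refine Nat.le_of_mul_le_mul_right ?_ hk0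
    rw [mul_comm q]
    omega
  have hBf : B.card * (d / 2) ≤ q * (d / 2) := Nat.mul_le_mul_right _ hBq
  have hdν : d * S.card + d * ∑ i, m i ≤ d * (k * q) := by
    rw [← mul_add, ← hq]
    exact Nat.mul_le_mul_left _ hν
  -- A missing large class would cost `d / 2` edges, which is positive as `2 ≤ d`.
  have hBq' : B.card = q := by
    refine le_antisymm hBq (Nat.le_of_mul_le_mul_right (?_ : _ ≤ _ * (d / 2)) (by omega))
    omega
  -- The large classes alone exhaust the matching number, leaving nothing for `S` or for other
  -- classes.
  have hkq : k * q ≤ ∑ i ∈ B, m i := by rw [mul_comm, ← hBq']; exact hBm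
  have hS : S = ∅ := by
    rw [← Finset.card_eq_zero]
    omega
  subst hS
  have hmB : ∀ i ∈ B, m i = k := by
    have h : ∑ i ∈ B, k = ∑ i ∈ B, m i := by
      rw [Finset.sum_const, hBq', smul_eq_mul, mul_comm]
      omega
    exact fun i hi => ((Finset.sum_eq_sum_iff_of_le
      fun i hi => (Finset.mem_filter.1 hi).2).1 h i hi).symm
  have hmB' : ∀ i ∉ B, m i = 0 := by
    have h : ∑ i ∈ Bᶜ, m i = 0 := by omega
    intro i hi
    exact Finset.sum_eq_zero_iff.1 h i (Finset.mem_compl.2 hi)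
  have heq : ∀ i, e i = d * m i + if k ≤ m i then d / 2 else 0 := by
    have h : ∑ i, e i = ∑ i, (d * m i + if k ≤ m i then d / 2 else 0) := by
      rw [hsum]
      simp only [Finset.card_empty, mul_zero, zero_add] at hG hdν
      rw [hBq'] at h1 ⊢
      have h3 : d * (k * q) ≤ d * ∑ i, m i := Nat.mul_le_mul_left _ (by omega)
      exact le_antisymm h1 ((Nat.add_le_add_right hdν _).trans (hext.trans hG))
    exact fun i => (Finset.sum_eq_sum_iff_of_le fun i _ => hE i).1 h i (Finset.mem_univ i)
  -- A class outside `B` has at most one vertex, but a vertex shares its class with a neighbor.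
  have hpB : ∀ x, p x ∈ B := by
    intro x
    by_contra hx
    obtain ⟨y, hxy⟩ := hiso x
    have h0 := hmB' _ hx
    rw [hm, Nat.card_coe_set_eq] at h0
    have : ({x, y} : Set V).ncard ≤ {z | z ∉ (∅ : Finset V) ∧ p z = p x}.ncard := by
      refine Set.ncard_le_ncard ?_ (Set.toFinite _)
      rintro z (rfl | rfl)
      · simp
      · simpa using (hp _ _ hxy (by simp) (by simp)).symm
    rw [Set.ncard_pair hxy.ne] at this
    omega
  have hset : ∀ i : B, {x | (⟨p x, hpB x⟩ : B) = i} = {x | x ∉ (∅ : Finset V) ∧ p x = i} := by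
    intro i
    ext x
    simp [Subtype.ext_iff]
  have hei : ∀ i : B, d * k + d / 2 = (G.induce {x | (⟨p x, hpB x⟩ : B) = i}).edgeSet.ncard := by
    intro i
    have h := heq i
    rw [hmB i i.2, if_pos le_rfl] at h
    rw [hset, ← h]
  refine ⟨B, inferInstance, fun x => ⟨p x, hpB x⟩, ?_, ?_, ?_, fun i => (hei i).le⟩
  · intro x y hxy
    exact Subtype.ext (hp x y hxy (by simp) (by simp))
  · rw [Fintype.card_coe, hBq']
  · intro i
    classical
    have h1 := hm i
    rw [hmB i i.2, ← hset] at h1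
    have h2 := two_mul_ncard_edgeSet_le (G := G.induce {x | (⟨p x, hpB x⟩ : B) = i}) fun x =>
      (ncard_neighborSet_induce_le _ x).trans (hd x)
    rw [← hei, ← Nat.card_eq_fintype_card] at h2
    set t := Nat.card {x | (⟨p x, hpB x⟩ : B) = i} with ht
    rcases Nat.even_or_odd' t with ⟨a, ha | ha⟩
    -- On `2k` vertices the degrees allow only `d * k` edges.
    · have : a = k := by omega
      rw [ha, this] at h2
      have : d * (2 * k) = 2 * (d * k) := by ring
      omega
    · omega

end EdgeBound

/-! ### Uniqueness of the extremal classes. -/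

section Iso

lemma exists_equiv_comm_of_involutive_aux {V : Type u} {W : Type v} [Fintype V] [Fintype W]
    [DecidableEq V]
    (hcard : Fintype.card V = Fintype.card W) {σ : V → V} {τ : W → W}
    (hσ : ∀ x, σ (σ x) = x) (hτ : ∀ x, τ (τ x) = x) (hσ' : ∀ x, σ x ≠ x) (hτ' : ∀ x, τ x ≠ x)
    (a : V) (b : W)
    (e : {x // x ≠ a ∧ x ≠ σ a} ≃ {y // y ≠ b ∧ y ≠ τ b})
    (he : ∀ x y : {x // x ≠ a ∧ x ≠ σ a}, (y : V) = σ x → (e y : W) = τ (e x)) :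
    ∃ e : V ≃ W, (∀ x, e (σ x) = τ (e x)) ∧ e a = b := by
  let f : V → W := fun x => if h : x ≠ a ∧ x ≠ σ a then e ⟨x, h⟩ else if x = a then b else τ b
  have hfa : f a = b := by simp [f]
  have hfs : f (σ a) = τ b := by simp [f, hσ']
  have hfe : ∀ x (h : x ≠ a ∧ x ≠ σ a), f x = e ⟨x, h⟩ := fun x h => by simp [f, h]
  have hinj : Function.Injective f := by
    intro x y hxy
    by_cases hx : x ≠ a ∧ x ≠ σ a <;> by_cases hy : y ≠ a ∧ y ≠ σ a
    · rw [hfe x hx, hfe y hy] at hxy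
      simpa using e.injective (Subtype.ext hxy)
    · have h1 := (e ⟨x, hx⟩).2
      rw [← hfe x hx] at h1
      rcases (show y = a ∨ y = σ a by tauto) with rfl | rfl
      · exact absurd (hxy.trans hfa) h1.1
      · exact absurd (hxy.trans hfs) h1.2
    · have h1 := (e ⟨y, hy⟩).2
      rw [← hfe y hy] at h1
      rcases (show x = a ∨ x = σ a by tauto) with rfl | rfl
      · exact absurd (hxy.symm.trans hfa) h1.1
      · exact absurd (hxy.symm.trans hfs) h1.2
    · rcases (show x = a ∨ x = σ a by tauto) with h | h <;>
        rcases (show y = a ∨ y = σ a by tauto) with h' | h' <;>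
        rw [h, h'] at hxy ⊢ <;> simp only [hfa, hfs] at hxy
      · exact absurd hxy.symm (hτ' b)
      · exact absurd hxy (hτ' b)
  have hcomm : ∀ x, f (σ x) = τ (f x) := by
    intro x
    by_cases hx : x ≠ a ∧ x ≠ σ a
    · have hx' : σ x ≠ a ∧ σ x ≠ σ a :=
        ⟨fun h => hx.2 (by rw [← h, hσ]), fun h => hx.1 (by rw [← hσ x, h, hσ])⟩
      rw [hfe _ hx, hfe _ hx']
      exact he ⟨x, hx⟩ ⟨σ x, hx'⟩ rfl
    · rcases (show x = a ∨ x = σ a by tauto) with rfl | rfl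
      · rw [hfs, hfa]
      · rw [hσ, hfs, hfa, hτ]
  exact ⟨Equiv.ofBijective f ((Fintype.bijective_iff_injective_and_card f).2 ⟨hinj, hcard⟩),
    hcomm, hfa⟩

/-- Induction, removing one 2-cycle on each side. The recursion uses the first conjunct; the second
lets the neighbors of the deleted vertices correspond in `nonempty_iso_of_ncard_edgeSet_le`. -/
lemma exists_equiv_comm_of_involutive (n : ℕ) : ∀ {V : Type u} {W : Type v} [Fintype V] [Fintype W],
    Fintype.card V = n → Fintype.card W = n → ∀ {σ : V → V} {τ : W → W},
    (∀ x, σ (σ x) = x) → (∀ x, τ (τ x) = x) → (∀ x, σ x ≠ x) → (∀ x, τ x ≠ x) →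
    (∃ e : V ≃ W, ∀ x, e (σ x) = τ (e x)) ∧
      ∀ a b, ∃ e : V ≃ W, (∀ x, e (σ x) = τ (e x)) ∧ e a = b := by
  induction n using Nat.strong_induction_on with
  | _ n ih =>
  intro V W _ _ hV hW σ τ hσ hτ hσ' hτ'
  classical
  have key : ∀ a b, ∃ e : V ≃ W, (∀ x, e (σ x) = τ (e x)) ∧ e a = b := by
    intro a b
    have hcV : Fintype.card {x // x ≠ a ∧ x ≠ σ a} = n - 2 := by
      rw [Fintype.card_subtype, ← hV, ← Finset.card_pair (hσ' a).symm, ← Finset.card_compl]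
      congr 1
      ext x
      simp
    have hcW : Fintype.card {x // x ≠ b ∧ x ≠ τ b} = n - 2 := by
      rw [Fintype.card_subtype, ← hW, ← Finset.card_pair (hτ' b).symm, ← Finset.card_compl]
      congr 1
      ext x
      simp
    have hn : 0 < n := hV ▸ Fintype.card_pos_iff.2 ⟨a⟩
    have hσi : ∀ x : {x // x ≠ a ∧ x ≠ σ a}, σ x ≠ a ∧ σ x ≠ σ a := fun x =>
      ⟨fun h => x.2.2 (hσ x ▸ congrArg σ h), fun h => x.2.1 ((hσ x).symm.trans ((congrArg σ h).trans (hσ a)))⟩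
    have hτi : ∀ x : {x // x ≠ b ∧ x ≠ τ b}, τ x ≠ b ∧ τ x ≠ τ b := fun x =>
      ⟨fun h => x.2.2 (hτ x ▸ congrArg τ h), fun h => x.2.1 ((hτ x).symm.trans ((congrArg τ h).trans (hτ b)))⟩
    obtain ⟨⟨e, he⟩, -⟩ := ih (n - 2) (by omega) hcV hcW
      (σ := fun x => ⟨σ x, hσi x⟩) (τ := fun x => ⟨τ x, hτi x⟩)
      (fun x => Subtype.ext (hσ x)) (fun x => Subtype.ext (hτ x))
      (fun x h => hσ' x (congrArg Subtype.val h)) (fun x h => hτ' x (congrArg Subtype.val h))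
    refine exists_equiv_comm_of_involutive_aux (hV.trans hW.symm) hσ hτ hσ' hτ' a b e ?_
    intro x y hxy
    have h := congrArg Subtype.val (he x)
    rw [show y = ⟨σ x, hσi x⟩ from Subtype.ext hxy]
    exact h
  refine ⟨?_, key⟩
  rcases isEmpty_or_nonempty V with hV0 | ⟨⟨a⟩⟩
  · exact ⟨Fintype.equivOfCardEq (hV.trans hW.symm), fun x => isEmptyElim x⟩
  · have : Nonempty W := Fintype.card_pos_iff.1 (by
      rw [hW, ← hV]
      exact Fintype.card_pos_iff.2 ⟨a⟩)
    obtain ⟨e, he, -⟩ := key a this.some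
    exact ⟨e, he⟩

/-- The structure of a graph with `2 * k + 1` vertices, no isolated vertices and `k + 1` edges:
deleting a suitable vertex `b` with unique neighbor `a` leaves a perfect matching. -/
lemma exists_involutive_of_ncard_edgeSet_le {V : Type u} [Fintype V] {F : SimpleGraph V} {k : ℕ}
    (hV : Fintype.card V = 2 * k + 1) (hF : ∀ x, ∃ y, F.Adj x y) (hE : F.edgeSet.ncard ≤ k + 1) :
    ∃ (b : V) (a : {x // x ≠ b}) (σ : {x // x ≠ b} → {x // x ≠ b}),
      (∀ x, σ (σ x) = x) ∧ (∀ x, σ x ≠ x) ∧ (∀ x, F.Adj b x ↔ x = a) ∧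
      ∀ x y : {x // x ≠ b}, F.Adj x y ↔ y = σ x := by
  classical
  have hpos : ∀ x, 1 ≤ (F.neighborSet x).ncard := by
    intro x
    obtain ⟨y, hy⟩ := hF x
    exact (Set.ncard_pos (Set.toFinite _)).2 ⟨y, hy⟩
  have hs := sum_ncard_neighborSet F
  have hs1 : ∑ x, (F.neighborSet x).ncard = ∑ x, ((F.neighborSet x).ncard - 1) + (2 * k + 1) := by
    rw [← hV, ← Finset.card_univ, Finset.card_eq_sum_ones, ← Finset.sum_add_distrib]
    exact Finset.sum_congr rfl fun x _ => (Nat.sub_add_cancel (hpos x)).symm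
  -- The degree sum is even and between `2k + 1` and `2k + 2`, so one vertex `w` has degree 2 and
  -- all others have degree 1.
  have hs2 : ∑ x, ((F.neighborSet x).ncard - 1) = 1 := by omega
  obtain ⟨w, hw⟩ : ∃ w, (F.neighborSet w).ncard - 1 ≠ 0 := by
    by_contra! h
    simp [h] at hs2
  rw [← Finset.add_sum_erase _ _ (Finset.mem_univ w)] at hs2
  have hw2 : (F.neighborSet w).ncard = 2 := by omega
  have h1 : ∀ x, x ≠ w → ∃ y, F.neighborSet x = {y} := by
    intro x hx
    have h0 : ∑ x ∈ Finset.univ.erase w, ((F.neighborSet x).ncard - 1) = 0 := by omega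
    have := Finset.sum_eq_zero_iff.1 h0 x (Finset.mem_erase.2 ⟨hx, Finset.mem_univ x⟩)
    have := hpos x
    exact Set.ncard_eq_one.1 (by omega)
  obtain ⟨a, b, hab, hwab⟩ := Set.ncard_eq_two.1 hw2
  have hadjw : ∀ x, F.Adj w x ↔ x = a ∨ x = b := by
    intro x
    rw [← mem_neighborSet, hwab]
    simp
  have hwb : w ≠ b := ((hadjw b).2 (.inr rfl)).ne
  have hbadj : ∀ x, F.Adj b x ↔ x = w := by
    intro x
    obtain ⟨y, hy⟩ := h1 b hwb.symm
    have hbw : w ∈ F.neighborSet b := ((hadjw b).2 (.inr rfl)).symm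
    rw [← mem_neighborSet, hy]
    rw [hy] at hbw
    simp only [Set.mem_singleton_iff] at hbw ⊢
    rw [hbw]
  have huniq : ∀ x : {x // x ≠ b}, ∃ y : {x // x ≠ b}, ∀ z : {x // x ≠ b}, F.Adj x z ↔ z = y := by
    rintro ⟨x, hx⟩
    by_cases hxw : x = w
    · subst hxw
      refine ⟨⟨a, hab⟩, fun z => ?_⟩
      rw [hadjw, Subtype.ext_iff]
      simp [z.2]
    · obtain ⟨y, hy⟩ := h1 x hxw
      have hxy : ∀ z, F.Adj x z ↔ z = y := by
        intro z
        rw [← mem_neighborSet, hy]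
        simp
      have hyb : y ≠ b := by
        rintro rfl
        exact hxw ((hbadj x).1 ((hxy y).2 rfl).symm)
      refine ⟨⟨y, hyb⟩, fun z => ?_⟩
      rw [hxy, Subtype.ext_iff]
  choose σ hσ using huniq
  refine ⟨b, ⟨w, hwb⟩, σ, fun x => ?_, fun x hx => ?_, hbadj, hσ⟩
  · exact ((hσ _ _).1 ((hσ x _).2 rfl).symm).symm
  · exact F.irrefl ((hσ x x).2 hx.symm)

lemma nonempty_iso_of_ncard_edgeSet_le {V : Type u} {W : Type v} [Fintype V] [Fintype W]
    {F : SimpleGraph V} {H : SimpleGraph W} {k : ℕ}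
    (hV : Fintype.card V = 2 * k + 1) (hF : ∀ x, ∃ y, F.Adj x y) (hFE : F.edgeSet.ncard ≤ k + 1)
    (hW : Fintype.card W = 2 * k + 1) (hH : ∀ x, ∃ y, H.Adj x y) (hHE : H.edgeSet.ncard ≤ k + 1) :
    Nonempty (F ≃g H) := by
  classical
  obtain ⟨b, a, σ, hσ, hσ', hb, hF⟩ := exists_involutive_of_ncard_edgeSet_le hV hF hFE
  obtain ⟨b', a', τ, hτ, hτ', hb', hH⟩ := exists_involutive_of_ncard_edgeSet_le hW hH hHE
  obtain ⟨e, he, hea⟩ := (exists_equiv_comm_of_involutive (2 * k)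
    (by simp [hV]) (by simp [hW]) hσ hτ hσ' hτ').2 a a'
  let g : V ≃ W := ((Equiv.optionSubtypeNe b).symm.trans e.optionCongr).trans
    (Equiv.optionSubtypeNe b')
  have hgb : g b = b' := by simp [g]
  have hge : ∀ x : {x // x ≠ b}, g x = e x := by
    intro x
    simp [g, Equiv.optionSubtypeNe_symm_of_ne x.2]
  have hbx : ∀ x : {x // x ≠ b}, H.Adj b' (e x) ↔ F.Adj b x := by
    intro x
    rw [hb, hb', ← hea, Subtype.coe_inj, Subtype.coe_inj, e.apply_eq_iff_eq]
  refine ⟨⟨g, ?_⟩⟩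
  intro x y
  by_cases hx : x = b
  · by_cases hy : y = b
    · simp [hx, hy]
    · rw [hx, hgb, hge ⟨y, hy⟩]
      exact hbx ⟨y, hy⟩
  · by_cases hy : y = b
    · rw [hy, hgb, hge ⟨x, hx⟩, H.adj_comm, F.adj_comm]
      exact hbx ⟨x, hx⟩
    · rw [hge ⟨x, hx⟩, hge ⟨y, hy⟩, hH, ← he, e.apply_eq_iff_eq]
      exact (hF ⟨x, hx⟩ ⟨y, hy⟩).symm

lemma ncard_edgeSet_compl_add {V : Type u} [Fintype V] (F : SimpleGraph V) :
    Fᶜ.edgeSet.ncard + F.edgeSet.ncard = (Fintype.card V).choose 2 := by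
  classical
  rw [← card_edgeFinset_top_eq_card_choose_two, ← ncard_edgeSet_eq_card,
    ← Set.ncard_union_eq _ (Set.toFinite _) (Set.toFinite _), ← edgeSet_sup, sup_comm,
    sup_compl_eq_top]
  exact disjoint_edgeSet.2 disjoint_compl_left

lemma ncard_neighborSet_compl {V : Type u} [Fintype V] (F : SimpleGraph V) (x : V) :
    (Fᶜ.neighborSet x).ncard = Fintype.card V - 1 - (F.neighborSet x).ncard := by
  classical
  rw [ncard_neighborSet_eq_degree, ncard_neighborSet_eq_degree, degree_compl]

lemma exists_adj_compl {V : Type u} [Fintype V] {d : ℕ} {F : SimpleGraph V}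
    (hV : d + 2 ≤ Fintype.card V) (hF : ∀ x, (F.neighborSet x).ncard ≤ d) (x : V) :
    ∃ y, Fᶜ.Adj x y := by
  have := ncard_neighborSet_compl F x
  have := hF x
  exact (Set.ncard_pos (Set.toFinite (Fᶜ.neighborSet x))).1 (by omega)

/-- With `k = ⌈d/2⌉` there are `k(2k + 1)` pairs; the assumed edges are all of them if `d = 2k`, and
all but `k + 1` if `d = 2k - 1`. -/
lemma ncard_edgeSet_compl_le {V : Type u} [Fintype V] {d : ℕ} {F : SimpleGraph V}
    (hV : Fintype.card V = 2 * ((d + 1) / 2) + 1)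
    (hFE : d * ((d + 1) / 2) + d / 2 ≤ F.edgeSet.ncard) :
    Fᶜ.edgeSet.ncard ≤ if Even d then 0 else (d + 1) / 2 + 1 := by
  have h := ncard_edgeSet_compl_add F
  rw [hV, Nat.choose_two_right] at h
  rcases Nat.even_or_odd' d with ⟨m, rfl | rfl⟩
  · rw [if_pos (by simp)]
    have h1 : (2 * m + 1) / 2 = m := by omega
    have h2 : 2 * m / 2 = m := by omega
    rw [h1] at h hFE
    rw [h2] at hFE
    have : (2 * m + 1) * (2 * m + 1 - 1) = 2 * (2 * m * m + m) := by
      rw [Nat.add_sub_cancel]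
      ring
    omega
  · rw [if_neg (by simp)]
    have h1 : (2 * m + 1 + 1) / 2 = m + 1 := by omega
    have h2 : (2 * m + 1) / 2 = m := by omega
    rw [h1] at h hFE ⊢
    rw [h2] at hFE
    have : (2 * (m + 1) + 1) * (2 * (m + 1) + 1 - 1) = 2 * ((2 * m + 1) * (m + 1) + m + m + 2) := by
      rw [Nat.add_sub_cancel]
      ring
    omega

/-- The complements are sparse enough to classify. For odd `d` there are `d + 2` vertices, so the
degree bound excludes isolated vertices in the complement. -/
lemma nonempty_iso_of_le_ncard_edgeSet {V : Type u} {W : Type v} [Fintype V] [Fintype W]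
    {F : SimpleGraph V} {H : SimpleGraph W} {d : ℕ}
    (hV : Fintype.card V = 2 * ((d + 1) / 2) + 1) (hF : ∀ x, (F.neighborSet x).ncard ≤ d)
    (hFE : d * ((d + 1) / 2) + d / 2 ≤ F.edgeSet.ncard)
    (hW : Fintype.card W = 2 * ((d + 1) / 2) + 1) (hH : ∀ x, (H.neighborSet x).ncard ≤ d)
    (hHE : d * ((d + 1) / 2) + d / 2 ≤ H.edgeSet.ncard) :
    Nonempty (F ≃g H) := by
  suffices Nonempty (Fᶜ ≃g Hᶜ) by
    obtain ⟨e⟩ := this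
    refine ⟨⟨e.toEquiv, ?_⟩⟩
    intro x y
    have h := e.map_adj_iff (v := x) (w := y)
    have hinj : e x = e y ↔ x = y := e.toEquiv.apply_eq_iff_eq
    rw [compl_adj, compl_adj, Ne, hinj] at h
    by_cases hxy : x = y
    · subst hxy
      simp
    · exact not_iff_not.1 (by simpa [hxy] using h)
  have h1 := ncard_edgeSet_compl_le hV hFE
  have h2 := ncard_edgeSet_compl_le hW hHE
  by_cases hd : Even d
  · rw [if_pos hd, Nat.le_zero, Set.ncard_eq_zero, edgeSet_eq_empty] at h1 h2
    rw [h1, h2]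
    exact ⟨⟨Fintype.equivOfCardEq (hV.trans hW.symm), by simp⟩⟩
  · rw [if_neg hd] at h1 h2
    rw [Nat.not_even_iff_odd] at hd
    obtain ⟨m, rfl⟩ := hd
    exact nonempty_iso_of_ncard_edgeSet_le hV (exists_adj_compl (by omega) hF) h1 hW
      (exists_adj_compl (by omega) hH) h2

/-- Graphs whose vertices are partitioned into pairwise nonadjacent classes are isomorphic if
corresponding classes are. -/
lemma nonempty_iso_of_classes {V : Type u} {W : Type v} {ι κ : Type*} {G : SimpleGraph V}
    {H : SimpleGraph W} {p : V → ι} {q : W → κ} (hp : ∀ x y, G.Adj x y → p x = p y)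
    (hq : ∀ x y, H.Adj x y → q x = q y) (σ : ι ≃ κ)
    (h : ∀ i, Nonempty (G.induce {x | p x = i} ≃g H.induce {y | q y = σ i})) :
    Nonempty (G ≃g H) := by
  have φ := fun i => (h i).some
  let f : V → W := fun x => (φ (p x) ⟨x, rfl⟩).1
  have hf : ∀ i x (hx : p x = i), f x = (φ i ⟨x, hx⟩).1 := by
    rintro _ x rfl
    rfl
  have hqf : ∀ x, q (f x) = σ (p x) := fun x => (φ (p x) ⟨x, rfl⟩).2
  have hinj : Function.Injective f := by
    intro x y hxy
    have hpxy : p x = p y := σ.injective (by rw [← hqf, ← hqf, hxy])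
    rw [hf _ x hpxy, hf _ y rfl] at hxy
    simpa using (φ (p y)).injective (Subtype.ext hxy)
  have hsurj : Function.Surjective f := by
    intro y
    obtain ⟨⟨x, hx⟩, hxy⟩ := (φ (σ.symm (q y))).surjective ⟨y, by simp⟩
    exact ⟨x, by rw [hf _ x hx, hxy]⟩
  refine ⟨⟨Equiv.ofBijective f ⟨hinj, hsurj⟩, ?_⟩⟩
  intro x y
  change H.Adj (f x) (f y) ↔ G.Adj x y
  by_cases hpxy : p x = p y
  · rw [hf _ x hpxy, hf _ y rfl]
    exact (φ (p y)).map_adj_iff (v := ⟨x, hpxy⟩) (w := ⟨y, rfl⟩)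
  · refine iff_of_false (fun h => hpxy (σ.injective ?_)) (fun h => hpxy (hp _ _ h))
    rw [← hqf, ← hqf, hq _ _ h]

end Iso

/-! ### Extremal graphs and operations on them. -/

section Models

/-- `G` has no isolated vertices, its maximum degree is `d` (unless it is empty), it has at least
`e` edges and its matchings have at most `m` edges. -/
structure IsModel {V : Type u} (G : SimpleGraph V) (d m e : ℕ) : Prop where
  exists_adj : ∀ x, ∃ y, G.Adj x y
  degree_le : ∀ x, (G.neighborSet x).ncard ≤ d
  exists_degree_eq : Nonempty V → ∃ x, (G.neighborSet x).ncard = d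
  le_ncard_edgeSet : e ≤ G.edgeSet.ncard
  card_le_of_disjoint : ∀ M : Finset (Sym2 V), (∀ e ∈ M, e ∈ G.edgeSet) →
    (∀ e ∈ M, ∀ e' ∈ M, ∀ x, x ∈ e → x ∈ e' → e = e') → M.card ≤ m

variable {V : Type u} {W : Type v} {G : SimpleGraph V} {H : SimpleGraph W} {d m m' e e' : ℕ}

lemma IsModel.matchingNumber_le [Finite V] (h : G.IsModel d m e) : G.matchingNumber ≤ m := by
  classical
  refine SimpleGraph.matchingNumber_le fun M hM => ?_
  have := Fintype.ofFinite V
  rw [Set.ncard_eq_toFinset_card']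
  refine h.card_le_of_disjoint _ (fun e he => M.edgeSet_subset (by simpa using he)) ?_
  intro e he e' he' x hx hx'
  obtain ⟨y, rfl⟩ := Sym2.mem_iff_exists.1 hx
  obtain ⟨z, rfl⟩ := Sym2.mem_iff_exists.1 hx'
  rw [hM.eq_of_adj_left (show M.Adj x y by simpa using he) (show M.Adj x z by simpa using he')]

/-- The Chvátal–Hanson bound is strictly increasing in the matching number, so having this many
edges forces `ν ≥ m`. Constructions thus never need to exhibit a matching. -/
lemma IsModel.matchingNumber_eq [Fintype V] (hd : 0 < d)
    (h : G.IsModel d m (d * m + (m / ((d + 1) / 2)) * (d / 2))) : G.matchingNumber = m := by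
  refine le_antisymm h.matchingNumber_le ?_
  by_contra! hlt
  have h1 := h.le_ncard_edgeSet.trans (ncard_edgeSet_le hd h.degree_le)
  have h2 : G.matchingNumber / ((d + 1) / 2) * (d / 2) ≤ m / ((d + 1) / 2) * (d / 2) :=
    Nat.mul_le_mul_right _ (Nat.div_le_div_right hlt.le)
  have h3 : d * (G.matchingNumber + 1) ≤ d * m := Nat.mul_le_mul_left _ hlt
  rw [mul_add] at h3
  omega

lemma IsModel.ncard_edgeSet_eq [Fintype V] (hd : 0 < d)
    (h : G.IsModel d m (d * m + (m / ((d + 1) / 2)) * (d / 2))) :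
    G.edgeSet.ncard = d * m + (m / ((d + 1) / 2)) * (d / 2) := by
  refine le_antisymm ?_ h.le_ncard_edgeSet
  have h1 := ncard_edgeSet_le hd h.degree_le
  rwa [h.matchingNumber_eq hd] at h1

lemma two_mul_card_le_of_disjoint [Fintype V] (M : Finset (Sym2 V)) (hM : ∀ e ∈ M, e ∈ G.edgeSet)
    (hM' : ∀ e ∈ M, ∀ e' ∈ M, ∀ x, x ∈ e → x ∈ e' → e = e') :
    2 * M.card ≤ Fintype.card V := by
  classical
  have h := Finset.card_biUnion (s := M) (t := fun e => e.toFinset) (by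
    intro e he e' he' hne
    rw [Function.onFun, Finset.disjoint_left]
    intro x hx hx'
    exact hne (hM' e he e' he' x (by simpa using hx) (by simpa using hx')))
  rw [Finset.sum_congr rfl fun e he => Sym2.card_toFinset_of_not_isDiag e
    (G.not_isDiag_of_mem_edgeSet (hM e he)), Finset.sum_const, smul_eq_mul, mul_comm] at h
  rw [← h]
  exact Finset.card_le_univ _

/-- The degrees fall short of `d` by at most 1 in total, so all are positive and some equals `d`.
The number of vertices bounds matchings. -/
lemma isModel_of_card_eq [Fintype V] (hm : 0 < m) (hd2 : 2 ≤ d)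
    (hV : Fintype.card V = 2 * m + 1) (hd : ∀ x, (G.neighborSet x).ncard ≤ d)
    (hE : d * (2 * m + 1) ≤ 2 * G.edgeSet.ncard + 1) :
    G.IsModel d m (d * m + d / 2) := by
  classical
  have hsum := sum_ncard_neighborSet G
  have hall : ∀ x, d ≤ (G.neighborSet x).ncard + 1 := by
    intro x
    rw [← Finset.add_sum_erase _ _ (Finset.mem_univ x)] at hsum
    have h1 : ∑ y ∈ Finset.univ.erase x, (G.neighborSet y).ncard ≤ (2 * m) • d := by
      refine (Finset.sum_le_card_nsmul _ _ d fun y _ => hd y).trans_eq ?_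
      rw [Finset.card_erase_of_mem (Finset.mem_univ _), Finset.card_univ, hV, Nat.add_sub_cancel]
    rw [smul_eq_mul] at h1
    have h2 : d * (2 * m + 1) = 2 * m * d + d := by ring
    omega
  refine ⟨fun x => ?_, hd, fun _ => ?_, ?_, fun M hM hM' => ?_⟩
  · have := hall x
    exact (Set.ncard_pos (Set.toFinite (G.neighborSet x))).1 (by omega)
  · by_contra! hne
    have h1 : ∑ y, (G.neighborSet y).ncard ≤ (2 * m + 1) • (d - 1) := by
      rw [← hV, ← Finset.card_univ]
      exact Finset.sum_le_card_nsmul _ _ _ fun y _ => Nat.le_sub_one_of_lt ((hd y).lt_of_ne (hne y))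
    obtain ⟨c, rfl⟩ : ∃ c, d = c + 1 := ⟨d - 1, by omega⟩
    rw [smul_eq_mul, Nat.add_sub_cancel] at h1
    have h2 : (c + 1) * (2 * m + 1) = (2 * m + 1) * c + 2 * m + 1 := by ring
    omega
  · have h2 : d * (2 * m + 1) = 2 * (d * m) + d := by ring
    omega
  · have := two_mul_card_le_of_disjoint M hM hM'
    omega

lemma exists_degree_lt [Fintype V] (hV : Odd (Fintype.card V)) (hd : Odd d)
    (hdeg : ∀ x, (G.neighborSet x).ncard ≤ d) : ∃ x, (G.neighborSet x).ncard < d := by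
  by_contra! h
  have hsum := sum_ncard_neighborSet G
  rw [Finset.sum_congr rfl fun x _ => le_antisymm (hdeg x) (h x), Finset.sum_const,
    Finset.card_univ, smul_eq_mul] at hsum
  have := hV.mul hd
  rw [hsum] at this
  exact (Nat.not_odd_iff_even.2 (even_two_mul _)) this

lemma card_preimage_map_le {ι : Type w} {f : ι → V} (hf : Function.Injective f) {K : SimpleGraph ι}
    (hK : ∀ x y, G.Adj (f x) (f y) → K.Adj x y) (h : K.IsModel d m e) {M : Finset (Sym2 V)}
    (hM : ∀ e ∈ M, e ∈ G.edgeSet)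
    (hM' : ∀ e ∈ M, ∀ e' ∈ M, ∀ x, x ∈ e → x ∈ e' → e = e') :
    (M.preimage (Sym2.map f) (Sym2.map.injective hf).injOn).card ≤ m := by
  refine h.card_le_of_disjoint _ (fun e he => ?_) fun e he e' he' x hx hx' => ?_
  · rw [Finset.mem_preimage] at he
    have := hM _ he
    induction e with
    | h x y => exact hK x y (by simpa using this)
  · rw [Finset.mem_preimage] at he he'
    exact Sym2.map.injective hf (hM' _ he _ he' (f x) (Sym2.mem_map.2 ⟨x, hx, rfl⟩)
      (Sym2.mem_map.2 ⟨x, hx', rfl⟩))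

lemma IsModel.sum [Finite V] [Finite W] (hG : G.IsModel d m e) (hH : H.IsModel d m' e') :
    (G ⊕g H).IsModel d (m + m') (e + e') := by
  classical
  have hl : ∀ x, ((G ⊕g H).neighborSet (.inl x)).ncard = (G.neighborSet x).ncard := fun x => by
    rw [neighborSet_sum_inl, Set.ncard_image_of_injective _ Sum.inl_injective]
  have hr : ∀ x, ((G ⊕g H).neighborSet (.inr x)).ncard = (H.neighborSet x).ncard := fun x => by
    rw [neighborSet_sum_inr, Set.ncard_image_of_injective _ Sum.inr_injective]
  refine ⟨?_, ?_, ?_, ?_, ?_⟩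
  · rintro (x | x)
    · obtain ⟨y, hy⟩ := hG.exists_adj x
      exact ⟨.inl y, by simpa using hy⟩
    · obtain ⟨y, hy⟩ := hH.exists_adj x
      exact ⟨.inr y, by simpa using hy⟩
  · rintro (x | x)
    · rw [hl]; exact hG.degree_le x
    · rw [hr]; exact hH.degree_le x
  · rintro ⟨x | x⟩
    · obtain ⟨y, hy⟩ := hG.exists_degree_eq ⟨x⟩
      exact ⟨.inl y, (hl y).trans hy⟩
    · obtain ⟨y, hy⟩ := hH.exists_degree_eq ⟨x⟩
      exact ⟨.inr y, (hr y).trans hy⟩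
  · rw [← Nat.card_coe_set_eq, Nat.card_congr edgeSetSumEquiv, Nat.card_sum, Nat.card_coe_set_eq,
      Nat.card_coe_set_eq]
    exact add_le_add hG.le_ncard_edgeSet hH.le_ncard_edgeSet
  · intro M hM hM'
    have h1 := card_preimage_map_le (f := Sum.inl) Sum.inl_injective (by simp) hG hM hM'
    have h2 := card_preimage_map_le (f := Sum.inr) Sum.inr_injective (by simp) hH hM hM'
    rw [Finset.card_preimage] at h1 h2
    refine le_trans (Finset.card_le_card (t := _ ∪ _) ?_)
      ((Finset.card_union_le _ _).trans (add_le_add h1 h2))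
    intro e he
    have := hM e he
    induction e with
    | h x y =>
    rcases x with x | x <;> rcases y with y | y
    · exact Finset.mem_union_left _ (Finset.mem_filter.2 ⟨he, s(x, y), rfl⟩)
    · simp at this
    · simp at this
    · exact Finset.mem_union_right _ (Finset.mem_filter.2 ⟨he, s(x, y), rfl⟩)

/-- The graph `G` together with a new vertex, adjacent to the vertices in `A` and to `t` new
leaves. -/
def attachStar (G : SimpleGraph V) (A : Set V) (t : ℕ) : SimpleGraph (V ⊕ Option (Fin t)) where
  Adj
    | .inl x, .inl y => G.Adj x y
    | .inl x, .inr none => x ∈ A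
    | .inr none, .inl x => x ∈ A
    | .inr none, .inr (some _) => True
    | .inr (some _), .inr none => True
    | _, _ => False
  symm := ⟨by
    rintro (x | _ | i) (y | _ | j) h
    all_goals first | exact h | exact G.adj_symm h⟩
  loopless := ⟨by
    rintro (x | _ | i) h
    · exact G.irrefl h
    · exact h
    · exact h⟩

lemma ncard_neighborSet_attachStar_inl_le [Finite V] {A : Set V} {t : ℕ} (hA : ∀ x ∈ A, (G.neighborSet x).ncard < d)
    (hG : ∀ x, (G.neighborSet x).ncard ≤ d) (x : V) :
    ((G.attachStar A t).neighborSet (.inl x)).ncard ≤ d := by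
  by_cases hx : x ∈ A
  · have hsub : (G.attachStar A t).neighborSet (.inl x) ⊆
        insert (.inr none) (Sum.inl '' G.neighborSet x) := by
      rintro (y | _ | i) hy
      · exact .inr ⟨y, hy, rfl⟩
      · exact .inl rfl
      · exact hy.elim
    refine (Set.ncard_le_ncard hsub (Set.toFinite _)).trans ((Set.ncard_insert_le _ _).trans ?_)
    rw [Set.ncard_image_of_injective _ Sum.inl_injective]
    exact hA x hx
  · have hsub : (G.attachStar A t).neighborSet (.inl x) ⊆ Sum.inl '' G.neighborSet x := by
      rintro (y | _ | i) hy
      · exact ⟨y, hy, rfl⟩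
      · exact absurd hy hx
      · exact hy.elim
    refine (Set.ncard_le_ncard hsub (Set.toFinite _)).trans ?_
    rw [Set.ncard_image_of_injective _ Sum.inl_injective]
    exact hG x

lemma ncard_neighborSet_attachStar_none [Finite V] {A : Set V} {t : ℕ} :
    ((G.attachStar A t).neighborSet (.inr none)).ncard = A.ncard + t := by
  have h : (G.attachStar A t).neighborSet (.inr none) =
      Sum.inl '' A ∪ (Sum.inr ∘ some) '' (Set.univ : Set (Fin t)) := by
    ext z
    rw [mem_neighborSet]
    rcases z with y | _ | i
    · simp [attachStar]
    · simp [attachStar]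
    · simp [attachStar]
  rw [h, Set.ncard_union_eq _ (Set.toFinite _) (Set.toFinite _),
    Set.ncard_image_of_injective _ Sum.inl_injective,
    Set.ncard_image_of_injective _ (Sum.inr_injective.comp (Option.some_injective _)),
    Set.ncard_univ, Nat.card_fin]
  rw [Set.disjoint_left]
  rintro _ ⟨x, -, rfl⟩ ⟨y, -, h⟩
  simp at h

/-- Every new edge contains the new center, so a matching gains at most one edge, while the center
brings `d` edges. -/
lemma IsModel.attachStar [Finite V] {A : Set V} {t : ℕ} (hG : G.IsModel d m e) (hd : 0 < d)
    (hA : ∀ x ∈ A, (G.neighborSet x).ncard < d) (hAt : A.ncard + t = d) :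
    (G.attachStar A t).IsModel d (m + 1) (e + d) := by
  classical
  have := Fintype.ofFinite V
  have hc : ((G.attachStar A t).neighborSet (.inr none)).ncard = d := by
    rw [ncard_neighborSet_attachStar_none, hAt]
  refine ⟨?_, ?_, fun _ => ⟨_, hc⟩, ?_, ?_⟩
  · rintro (x | _ | i)
    · obtain ⟨y, hy⟩ := hG.exists_adj x
      exact ⟨.inl y, hy⟩
    · exact (Set.ncard_pos (Set.toFinite _)).1 (hc.symm ▸ hd)
    · exact ⟨.inr none, trivial⟩
  · rintro (x | _ | i)
    · exact ncard_neighborSet_attachStar_inl_le hA hG.degree_le x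
    · exact hc.le
    · have hsub : (G.attachStar A t).neighborSet (.inr (some i)) ⊆ {.inr none} := by
        rintro (y | _ | j) hy
        · exact hy.elim
        · rfl
        · exact hy.elim
      refine (Set.ncard_le_ncard hsub (Set.toFinite _)).trans ?_
      rw [Set.ncard_singleton]
      exact hd
  · have hsub : Sym2.map Sum.inl '' G.edgeSet ∪ (G.attachStar A t).incidenceSet (.inr none) ⊆
        (G.attachStar A t).edgeSet := by
      refine Set.union_subset ?_ (incidenceSet_subset _ _)
      rintro _ ⟨e, he, rfl⟩
      induction e with
      | h x y => exact he
    refine le_trans ?_ (Set.ncard_le_ncard hsub (Set.toFinite _))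
    rw [Set.ncard_union_eq _ (Set.toFinite _) (Set.toFinite _),
      Set.ncard_image_of_injective _ (Sym2.map.injective Sum.inl_injective)]
    · refine add_le_add hG.le_ncard_edgeSet ?_
      rw [← Nat.card_coe_set_eq, Nat.card_eq_fintype_card, card_incidenceSet_eq_degree,
        ← ncard_neighborSet_eq_degree, hc]
    · rw [Set.disjoint_left]
      rintro _ ⟨e, -, rfl⟩ ⟨-, h⟩
      simp [Sym2.mem_map] at h
  · intro M hM hM'
    have h1 := card_preimage_map_le (f := Sum.inl) Sum.inl_injective (K := G)
      (fun _ _ h => h) hG hM hM'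
    have h2 : (M.filter fun e => Sum.inr none ∈ e).card ≤ 1 := by
      rw [Finset.card_le_one]
      intro a ha b hb
      rw [Finset.mem_filter] at ha hb
      exact hM' a ha.1 b hb.1 _ ha.2 hb.2
    rw [Finset.card_preimage] at h1
    refine le_trans (Finset.card_le_card (t := _ ∪ _) ?_)
      ((Finset.card_union_le _ _).trans (add_le_add h1 h2))
    intro e he
    have := hM e he
    induction e with
    | h x y =>
    rcases x with x | _ | x <;> rcases y with y | _ | y
    · exact Finset.mem_union_left _ (Finset.mem_filter.2 ⟨he, s(x, y), rfl⟩)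
    all_goals first
      | exact (show False from this).elim
      | exact Finset.mem_union_right _ (Finset.mem_filter.2 ⟨he, by simp⟩)

end Models

/-! ### Non-uniqueness when `⌈d/2⌉` does not divide the matching number, and both implications. -/

section Existence

/-- There is a graph with `n` vertices satisfying `IsModel` with parameters `d`, `m`, `e`. -/
def HasModel (d n m e : ℕ) : Prop :=
  ∃ (V : Type v) (_ : Fintype V) (G : SimpleGraph V), Fintype.card V = n ∧ G.IsModel d m e

variable {d n m e n' m' e' : ℕ}

lemma hasModel_zero : HasModel.{v} d 0 0 0 :=
  ⟨PEmpty, inferInstance, ⊥, by simp, fun x => x.elim, fun x => x.elim, fun ⟨x⟩ => x.elim, by simp,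
    fun M hM _ => by
      rw [Nat.le_zero, Finset.card_eq_zero, Finset.eq_empty_iff_forall_notMem]
      exact fun e he => by simpa using hM e he⟩

lemma HasModel.add (h : HasModel.{v} d n m e) (h' : HasModel.{v} d n' m' e') :
    HasModel.{v} d (n + n') (m + m') (e + e') := by
  obtain ⟨V, _, G, hV, hG⟩ := h
  obtain ⟨W, _, H, hW, hH⟩ := h'
  exact ⟨V ⊕ W, inferInstance, G ⊕g H, by simp [hV, hW], hG.sum hH⟩

lemma HasModel.mul (h : HasModel.{v} d n m e) (a : ℕ) : HasModel.{v} d (a * n) (a * m) (a * e) := by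
  induction a with
  | zero => simpa using hasModel_zero
  | succ a ih => simpa only [Nat.succ_mul] using ih.add h

/-- Same gain as from a disjoint star, with `d` instead of `d + 1` additional vertices. -/
lemma IsModel.hasModel_attach {V : Type v} [Fintype V] {G : SimpleGraph V} (h : G.IsModel d m e)
    {x : V} (hx : (G.neighborSet x).ncard < d) :
    HasModel.{v} d (Fintype.card V + d) (m + 1) (e + d) := by
  refine ⟨_, inferInstance, _, ?_, h.attachStar (A := {x}) (t := d - 1) (by omega) (by simpa using hx)
    (by rw [Set.ncard_singleton]; omega)⟩
  simp
  omega

lemma hasModel_star (hd : 0 < d) : HasModel.{v} d (d + 1) 1 d := by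
  obtain ⟨V, _, G, hV, hG⟩ := hasModel_zero.{v} (d := d)
  exact ⟨V ⊕ Option (Fin d), inferInstance, _, by simp [hV],
    by simpa using hG.attachStar (A := ∅) (t := d) hd (by simp) (by simp)⟩

lemma hasModel_double_star (hd : 2 ≤ d) : HasModel.{v} d (2 * d + 1) 2 (2 * d) := by
  obtain ⟨V, _, G, hV, hG⟩ := hasModel_zero.{v} (d := d)
  have hG' := hG.attachStar (A := ∅) (t := d) (by omega) (by simp) (by simp)
  -- A leaf has degree at most 1, so a second star can share it.
  have hx : ((G.attachStar ∅ d).neighborSet (.inr (some ⟨0, by omega⟩))).ncard < d := by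
    refine lt_of_le_of_lt ((Set.ncard_le_ncard (t := {.inr none}) ?_ (Set.toFinite _)).trans
      (Set.ncard_singleton _).le) hd
    rintro (y | _ | j) hy
    · exact hy.elim
    · rfl
    · exact hy.elim
  have := hG'.hasModel_attach hx
  simp only [Fintype.card_sum, hV, Fintype.card_option, Fintype.card_fin] at this
  convert this using 1 <;> omega

lemma isModel_top {V : Type v} [Fintype V] {k : ℕ} (hk : 0 < k)
    (hV : Fintype.card V = 2 * k + 1) :
    (⊤ : SimpleGraph V).IsModel (2 * k) k (2 * k * k + k) := by
  classical
  have h := isModel_of_card_eq (G := (⊤ : SimpleGraph V)) (d := 2 * k) hk (by omega) hV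
    (fun x => by rw [ncard_neighborSet_eq_degree]; simp [hV])
    (by
      have h := ncard_edgeSet_compl_add (⊥ : SimpleGraph V)
      rw [compl_bot, edgeSet_bot, Set.ncard_empty, add_zero, Nat.choose_two_right, hV,
        Nat.add_sub_cancel] at h
      have h2 : (2 * k + 1) * (2 * k) = 2 * (2 * k * k + k) := by ring
      have h3 : 2 * k * (2 * k + 1) = 2 * (2 * k * k + k) := by ring
      rw [h2] at h
      omega)
  rwa [show 2 * k / 2 = k by omega] at h

lemma exists_isModel_odd {k : ℕ} (hk : 0 < k) (hd : d + 1 = 2 * k) (hd2 : 2 ≤ d) :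
    ∃ (V : Type v) (_ : Fintype V) (G : SimpleGraph V), Fintype.card V = 2 * k + 1 ∧
      G.IsModel d k (d * k + d / 2) := by
  classical
  let K := ULift.{v} (Fin k)
  -- `F` is a perfect matching on `K × Bool` with the vertex `none` hung onto it; the model is its
  -- complement.
  let f : Option K → Sym2 (Option (K × Bool)) := fun i =>
    i.elim s(none, some (⟨⟨0, hk⟩⟩, false)) fun i => s(some (i, false), some (i, true))
  let F : SimpleGraph (Option (K × Bool)) := fromEdgeSet (Set.range f)
  have hV : Fintype.card (Option (K × Bool)) = 2 * k + 1 := by simp [K]; omega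
  have hFE : F.edgeSet.ncard ≤ k + 1 := by
    rw [edgeSet_fromEdgeSet]
    refine (Set.ncard_le_ncard Set.sdiff_subset (Set.toFinite _)).trans ?_
    rw [← Set.image_univ]
    refine (Set.ncard_image_le (Set.toFinite _)).trans ?_
    simp [Set.ncard_univ, K]
  have hF : ∀ x, 1 ≤ (F.neighborSet x).ncard := by
    intro x
    refine (Set.ncard_pos (Set.toFinite (F.neighborSet x))).2 ?_
    rcases x with _ | ⟨i, _ | _⟩
    · exact ⟨some (⟨⟨0, hk⟩⟩, false), (fromEdgeSet_adj _).2 ⟨⟨none, rfl⟩, by simp⟩⟩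
    · exact ⟨some (i, true), (fromEdgeSet_adj _).2 ⟨⟨some i, rfl⟩, by simp⟩⟩
    · exact ⟨some (i, false), (fromEdgeSet_adj _).2 ⟨⟨some i, Sym2.eq_swap⟩, by simp⟩⟩
  refine ⟨_, inferInstance, Fᶜ, hV, isModel_of_card_eq hk hd2 hV (fun x => ?_) ?_⟩
  · rw [ncard_neighborSet_compl, hV]
    have := hF x
    omega
  · have h := ncard_edgeSet_compl_add F
    rw [hV, Nat.choose_two_right, Nat.add_sub_cancel] at h
    have h2 : (2 * k + 1) * (2 * k) = 2 * (2 * k * k + k) := by ring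
    rw [h2] at h
    obtain rfl : d = 2 * k - 1 := by omega
    have h3 : (2 * k - 1) * (2 * k + 1) + (2 * k + 1) = (2 * k + 1) * (2 * k) := by
      obtain ⟨c, rfl⟩ : ∃ c, k = c + 1 := ⟨k - 1, by omega⟩
      rw [show 2 * (c + 1) - 1 = 2 * c + 1 by omega]
      ring
    omega

/-- The complement of a cycle of length `2k + 3` is `2k`-regular. -/
lemma hasModel_compl_cycleGraph {k : ℕ} (hk : 0 < k) :
    HasModel.{v} (2 * k) (2 * (k + 1) + 1) (k + 1) (2 * k * (k + 1) + k) := by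
  classical
  let V := ULift.{v} (Fin (2 * k + 3))
  have hV : Fintype.card V = 2 * (k + 1) + 1 := by simp [V]; omega
  let F : SimpleGraph V := (cycleGraph (2 * k + 3)).comap ULift.down
  have hF : ∀ x, (F.neighborSet x).ncard = 2 := by
    intro x
    rw [← cycleGraph_degree_three_le (n := 2 * k) (v := x.down), ← ncard_neighborSet_eq_degree]
    exact Set.ncard_congr (fun y _ => y.down) (fun y hy => hy) (fun a b _ _ h => ULift.ext _ _ h)
      fun y hy => ⟨⟨y⟩, hy, rfl⟩
  have hdeg : ∀ x, (Fᶜ.neighborSet x).ncard = 2 * k := by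
    intro x
    rw [ncard_neighborSet_compl, hV, hF]
    omega
  have h := isModel_of_card_eq (G := Fᶜ) (m := k + 1) (Nat.succ_pos k) (d := 2 * k) (by omega) hV
    (fun x => (hdeg x).le) (by
      rw [← sum_ncard_neighborSet, Finset.sum_congr rfl fun x _ => hdeg x, Finset.sum_const,
        Finset.card_univ, hV, smul_eq_mul, mul_comm]
      omega)
  rw [show 2 * k / 2 = k by omega] at h
  exact ⟨V, inferInstance, Fᶜ, hV, h⟩

lemma hasModel_base (hd : 2 ≤ d) : HasModel.{v} d (2 * ((d + 1) / 2) + 1) ((d + 1) / 2)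
    (d * ((d + 1) / 2) + d / 2) := by
  rcases Nat.even_or_odd' d with ⟨k, rfl | rfl⟩
  · rw [show (2 * k + 1) / 2 = k by omega, show 2 * k / 2 = k by omega]
    exact ⟨ULift (Fin (2 * k + 1)), inferInstance, ⊤, by simp, isModel_top (by omega) (by simp)⟩
  · rw [show (2 * k + 1 + 1) / 2 = k + 1 by omega]
    exact exists_isModel_odd (by omega) (by omega) hd

/-- A model with the same parameters as the disjoint union of the base model and a star, but with
a different number of vertices. -/
lemma exists_hasModel_alternative (hd : 3 ≤ d) : ∃ n, n ≠ 2 * ((d + 1) / 2) + 1 + (d + 1) ∧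
    HasModel.{v} d n ((d + 1) / 2 + 1) (d * ((d + 1) / 2) + d / 2 + d) := by
  rcases Nat.even_or_odd' d with ⟨k, rfl | rfl⟩
  · rw [show (2 * k + 1) / 2 = k by omega, show 2 * k / 2 = k by omega]
    refine ⟨2 * (k + 1) + 1, by omega, ?_⟩
    · convert hasModel_compl_cycleGraph (k := k) (by omega) using 1
      ring
  · rw [show (2 * k + 1 + 1) / 2 = k + 1 by omega]
    obtain ⟨V, _, G, hV, hG⟩ := exists_isModel_odd.{v} (d := 2 * k + 1) (k := k + 1) (by omega)
      (by omega) (by omega)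
    -- Order and `d` are both odd, so the graph is not `d`-regular and has room for another edge.
    obtain ⟨x, hx⟩ := exists_degree_lt (hV ▸ ⟨k + 1, rfl⟩) ⟨k, rfl⟩ hG.degree_le
    refine ⟨_, ?_, hG.hasModel_attach hx⟩
    omega

/-- If `⌈d / 2⌉` does not divide `m`, there are extremal graphs with different numbers of
vertices. -/
lemma exists_hasModel_ne (hd : 2 ≤ d) (hm : 2 ≤ m) (hdvd : ¬ (d + 1) / 2 ∣ m) :
    ∃ n n', n ≠ n' ∧ HasModel.{v} d n m (d * m + (m / ((d + 1) / 2)) * (d / 2)) ∧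
      HasModel.{v} d n' m (d * m + (m / ((d + 1) / 2)) * (d / 2)) := by
  set k := (d + 1) / 2 with hk
  have hd3 : 3 ≤ d := by
    by_contra h
    have : k = 1 := by omega
    exact hdvd (this ▸ one_dvd m)
  have hmod := Nat.div_add_mod m k
  have hr : 0 < m % k := Nat.pos_of_ne_zero fun h => hdvd (Nat.dvd_of_mod_eq_zero h)
  set q := m / k
  obtain ⟨s, hs⟩ : ∃ s, m % k = s + 1 := ⟨m % k - 1, by omega⟩
  rw [hs] at hmod
  rw [← hmod]
  have hstar := hasModel_star.{v} (d := d) (by omega)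
  -- For `q = 0` only stars occur, at least two since `2 ≤ m`; otherwise there is a base graph and,
  -- since `k ∤ m`, also a star.
  rcases Nat.eq_zero_or_pos q with hq | hq
  · rw [hq] at hmod ⊢
    obtain ⟨r, rfl⟩ : ∃ r, s = r + 1 := ⟨s - 1, by omega⟩
    refine ⟨(r + 2) * (d + 1), r * (d + 1) + (2 * d + 1), ?_, ?_, ?_⟩
    rotate_left
    · convert hstar.mul (r + 2) using 1 <;> ring
    · convert (hstar.mul r).add (hasModel_double_star (d := d) hd) using 1 <;> ring
    · have : (r + 2) * (d + 1) = r * (d + 1) + 2 * d + 2 := by ring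
      omega
  · obtain ⟨c, hc⟩ : ∃ c, q = c + 1 := ⟨q - 1, by omega⟩
    rw [hc]
    have hbase := hasModel_base.{v} hd
    rw [← hk] at hbase
    obtain ⟨n, hn, hM⟩ := exists_hasModel_alternative.{v} hd3
    rw [← hk] at hn hM
    refine ⟨(c + 1) * (2 * k + 1) + (s + 1) * (d + 1),
      c * (2 * k + 1) + s * (d + 1) + n, ?_, ?_, ?_⟩
    rotate_left
    · convert (hbase.mul (c + 1)).add (hstar.mul (s + 1)) using 1 <;> ring
    · convert ((hbase.mul c).add (hstar.mul s)).add hM using 1 <;> ring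
    · have h1 : (c + 1) * (2 * k + 1) = c * (2 * k + 1) + (2 * k + 1) := by ring
      have h2 : (s + 1) * (d + 1) = s * (d + 1) + (d + 1) := by ring
      omega

lemma HasModel.card_eq_of_isUniqueUpToIso {V : Type u} [Fintype V] {G : SimpleGraph V}
    [DecidableRel G.Adj] (hG : IsUniqueUpToIso.{u, v} G) (hm : 0 < m) (hd : 0 < d)
    (hGd : G.maxDegree = d) (hGm : G.matchingNumber = m)
    (hGe : G.edgeFinset.card = d * m + (m / ((d + 1) / 2)) * (d / 2))
    (h : HasModel.{v} d n m (d * m + (m / ((d + 1) / 2)) * (d / 2))) : n = Fintype.card V := by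
  classical
  obtain ⟨W, _, H, rfl, hH⟩ := h
  -- Needed because models attain degree `d` only when nonempty.
  have hW : Nonempty W := by
    by_contra hW
    rw [not_nonempty_iff] at hW
    have := hH.le_ncard_edgeSet
    rw [Set.eq_empty_of_isEmpty H.edgeSet, Set.ncard_empty] at this
    have : 0 < d * m := Nat.mul_pos hd hm
    omega
  suffices Nonempty (G ≃g H) from (Fintype.card_congr this.some.toEquiv).symm
  refine hG W H (fun w hw => (hH.exists_adj w).elim fun y hy => hw y hy) ?_ ?_ ?_
  · rw [hGd]
    refine le_antisymm (H.maxDegree_le_of_forall_degree_le _ fun x => ?_) ?_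
    · rw [← ncard_neighborSet_eq_degree]
      exact hH.degree_le x
    · obtain ⟨x, hx⟩ := hH.exists_degree_eq hW
      rw [← hx, ncard_neighborSet_eq_degree]
      exact H.degree_le_maxDegree x
  · rw [hGm, hH.matchingNumber_eq hd]
  · rw [hGe, ← ncard_edgeSet_eq_card, hH.ncard_edgeSet_eq hd]

lemma isUniqueUpToIso_of_dvd {V : Type u} [Fintype V] {G : SimpleGraph V}
    [DecidableRel G.Adj] (hiso : ∀ x, ¬ G.IsIsolated x) (hd : 2 ≤ G.maxDegree)
    (hE : G.edgeFinset.card = G.maxDegree * G.matchingNumber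
        + (G.matchingNumber / ((G.maxDegree + 1) / 2)) * (G.maxDegree / 2))
    (hdvd : (G.maxDegree + 1) / 2 ∣ G.matchingNumber) : IsUniqueUpToIso.{u, v} G := by
  intro W _ H _ hH hHd hHm hHE
  have hGd : ∀ x, (G.neighborSet x).ncard ≤ G.maxDegree := fun x => by
    rw [ncard_neighborSet_eq_degree]
    exact G.degree_le_maxDegree x
  have hHd : ∀ x, (H.neighborSet x).ncard ≤ G.maxDegree := fun x => by
    rw [ncard_neighborSet_eq_degree, ← hHd]
    exact H.degree_le_maxDegree x
  obtain ⟨ι, _, p, hp, hι, hpn, hpe⟩ := exists_classes_of_extremal hd hGd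
    (fun x => by simpa [IsIsolated] using hiso x) hdvd (by rw [ncard_edgeSet_eq_card, hE])
  obtain ⟨κ, _, q, hq, hκ, hqn, hqe⟩ := exists_classes_of_extremal hd hHd
    (fun x => by simpa [IsIsolated] using hH x) (hHm ▸ hdvd)
    (by rw [ncard_edgeSet_eq_card, hHE, hE, hHm])
  classical
  refine nonempty_iso_of_classes hp hq (Fintype.equivOfCardEq (by rw [hι, hκ, hHm])) fun i => ?_
  exact nonempty_iso_of_le_ncard_edgeSet (d := G.maxDegree)
    (by rw [← Nat.card_eq_fintype_card, hpn])
    (fun x => (ncard_neighborSet_induce_le _ x).trans (hGd x)) (hpe i)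
    (by rw [← Nat.card_eq_fintype_card, hqn])
    (fun x => (ncard_neighborSet_induce_le _ x).trans (hHd x)) (hqe _)

end Existence

end SimpleGraph

theorem mainTheorem1 {V : Type u} [Fintype V] (G : SimpleGraph V) [DecidableRel G.Adj]
    (hiso : ∀ x, ¬ G.IsIsolated x)
    (hν : 2 ≤ G.matchingNumber) (hΔ : 2 ≤ G.maxDegree)
    (hE : G.edgeFinset.card =
      G.maxDegree * G.matchingNumber
        + (G.matchingNumber / (G.maxDegree ⌈/⌉ 2)) * (G.maxDegree / 2)) :
    SimpleGraph.IsUniqueUpToIso.{u, v} G ↔ (G.maxDegree ⌈/⌉ 2) ∣ G.matchingNumber := by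
  have hceil : G.maxDegree ⌈/⌉ 2 = (G.maxDegree + 1) / 2 := Nat.ceilDiv_eq_add_pred_div _ _
  rw [hceil] at hE ⊢
  refine ⟨fun h => ?_, SimpleGraph.isUniqueUpToIso_of_dvd hiso hΔ hE⟩
  by_contra hdvd
  obtain ⟨n, n', hne, hn, hn'⟩ := SimpleGraph.exists_hasModel_ne.{v} hΔ hν hdvd
  exact hne ((hn.card_eq_of_isUniqueUpToIso h (by omega) (by omega) rfl rfl hE).trans
    (hn'.card_eq_of_isUniqueUpToIso h (by omega) (by omega) rfl rfl hE).symm)
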